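/- Let $\mathbb K\in\{\mathbb R,\mathbb C\}$ and let $X,Y$ be Banach spaces over $\mathbb K$, with closed unit balls $B_X,B_Y$. Write $\mathcal L(X,W)$ for the space of bounded linear operators with the operator norm, and $X^*=\mathcal L(X,\mathbb K)$. Definitions. $Y$ has the Radon–Nikodým property (RNP) if every nonempty bounded set $D\subseteq Y$ is dentable, i.e. for each $\varepsilon>0$ there are $f\in Y^*$ and $\alpha>0$ such that the slice $\{y\in D:\operatorname{Re}f(y)>\sup_D\operatorname{Re}f-\alpha\}$ has diameter less than $\varepsilon$. A functional $f$ strongly exposes a point $x_0$ of a set $C$ if $\operatorname{Re}f(x_0)=\max_C\operatorname{Re}f$ and every sequence $(x_n)$ in $C$ with $\operatorname{Re}f(x_n)\to\operatorname{Re}f(x_0)$ converges in norm to $x_0$; such an $x_0$ is called a strongly exposed point of $C$. $\operatorname{SE}(X)$ is the set of $f\in X^*$ that strongly expose some point of $B_X$. A set $A\subseteq Y$ is countable up to rotations if there is a countable $S\subseteq A$ such that every $a\in A$ is of the form $\theta s$ with $s\in S$, $\theta\in\mathbb K$, $|\theta|=1$. $\operatorname{NA}(X,W)$ is the set of $T\in\mathcal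 L(X,W)$ for which there is $x\in X$ with $\|x\|=1$ and $\|Tx\|=\|T\|$. $\operatorname{ASE}(X,W)$ is the set of $T\in\mathcal L(X,W)$ for which there is $x_0\in B_X$ such that for every sequence $(x_n)$ in $B_X$ with $\|Tx_n\|\to\|T\|$ there are scalars $\theta_n$ of modulus one with $\theta_nx_n\to x_0$. A subset of a topological space is residual if it contains a countable intersection of dense open sets. Statement. Suppose that $Y$ has the RNP and that the set of strongly exposed points of $B_Y$ is countable up to rotations, and let $\mathcal I(X,Y^*)$ be a closed linear subspace of $\mathcal L(X,Y^*)$ that contains the rank one operators. Then: (a) If $\operatorname{NA}(X,\mathbb K)$ is residual in $X^*$, then $\operatorname{NA}(X,Y^*)\cap\mathcal I(X,Y^*)$ is residual in $\mathcal I(X,Y^*)$. (b) If $\operatorname{SE}(X)$ is dense in $X^*$, then the set of those $T\in\mathcal I(X,Y^*)$ at which the norm of $\mathcal L(X,Y^*)$ is Fréchet differentiable is dense in $\mathcal I(X,Y^*)$; in particular, if $Y\neq\{0\}$, then $\operatorname{ASE}(X,Y^*)\cap\mathcal I(X,Y^*)$ is dense in $\mathcal I(X,Y^*)$. -/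

import Mathlib

open Filter Topology Metric

noncomputable section

/-! Notions from the theory of norm attaining operators, over `𝕜 = ℝ` or `𝕜 = ℂ`. -/

/-- The slice of `D` given by the functional `f` and `α > 0`: the points of `D` at which
`Re f` is larger than `sup_D Re f - α`. -/
def slice {𝕜 E : Type*} [RCLike 𝕜] [NormedAddCommGroup E] [NormedSpace 𝕜 E]
    (D : Set E) (f : StrongDual 𝕜 E) (α : ℝ) : Set E :=
  {x ∈ D | sSup ((fun z => RCLike.re (f z)) '' D) - α < RCLike.re (f x)}

/-- A (nonempty bounded) set is dentable if it has slices of arbitrarily small diameter. -/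
def IsDentable (𝕜 : Type*) {E : Type*} [RCLike 𝕜] [NormedAddCommGroup E] [NormedSpace 𝕜 E]
    (D : Set E) : Prop :=
  ∀ ε > 0, ∃ (f : StrongDual 𝕜 E) (α : ℝ), 0 < α ∧ diam (slice D f α) < ε

/-- The Radon-Nikodym property: every nonempty bounded subset is dentable. -/
def HasRNP (𝕜 E : Type*) [RCLike 𝕜] [NormedAddCommGroup E] [NormedSpace 𝕜 E] : Prop :=
  ∀ D : Set E, D.Nonempty → Bornology.IsBounded D → IsDentable 𝕜 D

/-- The functional `f` strongly exposes the point `x₀` in `C`. -/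
def StronglyExposes {𝕜 E : Type*} [RCLike 𝕜] [NormedAddCommGroup E] [NormedSpace 𝕜 E]
    (f : StrongDual 𝕜 E) (C : Set E) (x₀ : E) : Prop :=
  x₀ ∈ C ∧ IsMaxOn (fun x => RCLike.re (f x)) C x₀ ∧
    ∀ u : ℕ → E, (∀ n, u n ∈ C) →
      Tendsto (fun n => RCLike.re (f (u n))) atTop (𝓝 (RCLike.re (f x₀))) →
      Tendsto u atTop (𝓝 x₀)

/-- The set of strongly exposed points of `C`. -/
def stronglyExposedPoints (𝕜 : Type*) {E : Type*} [RCLike 𝕜] [NormedAddCommGroup E]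
    [NormedSpace 𝕜 E] (C : Set E) : Set E :=
  {x₀ | ∃ f : StrongDual 𝕜 E, StronglyExposes f C x₀}

/-- `SE(X)`: the functionals which strongly expose some point of the closed unit ball. -/
def stronglyExposingFunctionals (𝕜 X : Type*) [RCLike 𝕜] [NormedAddCommGroup X]
    [NormedSpace 𝕜 X] : Set (StrongDual 𝕜 X) :=
  {f | ∃ x₀ : X, StronglyExposes f (closedBall (0 : X) 1) x₀}

/-- `A` is countable up to rotations: countably many elements of `A` suffice to represent every
element of `A` up to a scalar of modulus one. -/
def CountableUpToRotations (𝕜 : Type*) {E : Type*} [RCLike 𝕜] [NormedAddCommGroup E]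
    [NormedSpace 𝕜 E] (A : Set E) : Prop :=
  ∃ S : Set E, S ⊆ A ∧ S.Countable ∧ ∀ a ∈ A, ∃ s ∈ S, ∃ θ : 𝕜, ‖θ‖ = 1 ∧ a = θ • s

/-- `NA(X, W)`: the operators that attain their norm at a vector of norm one. -/
def normAttaining (𝕜 X W : Type*) [RCLike 𝕜] [NormedAddCommGroup X] [NormedSpace 𝕜 X]
    [NormedAddCommGroup W] [NormedSpace 𝕜 W] : Set (X →L[𝕜] W) :=
  {T | ∃ x : X, ‖x‖ = 1 ∧ ‖T x‖ = ‖T‖}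

/-- `T` absolutely strongly exposes `B`. -/
def AbsStronglyExposes {𝕜 X W : Type*} [RCLike 𝕜] [NormedAddCommGroup X] [NormedSpace 𝕜 X]
    [NormedAddCommGroup W] [NormedSpace 𝕜 W] (T : X →L[𝕜] W) (B : Set X) : Prop :=
  ∃ x₀ ∈ B, ∀ u : ℕ → X, (∀ n, u n ∈ B) →
    Tendsto (fun n => ‖T (u n)‖) atTop (𝓝 (sSup ((fun x => ‖T x‖) '' B))) →
    ∃ θ : ℕ → 𝕜, (∀ n, ‖θ n‖ = 1) ∧ Tendsto (fun n => θ n • u n) atTop (𝓝 x₀)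

/-- `ASE(X, W)`: the absolutely strongly exposing operators. -/
def absStronglyExposingOperators (𝕜 X W : Type*) [RCLike 𝕜] [NormedAddCommGroup X]
    [NormedSpace 𝕜 X] [NormedAddCommGroup W] [NormedSpace 𝕜 W] : Set (X →L[𝕜] W) :=
  {T | AbsStronglyExposes T (closedBall (0 : X) 1)}

/-- The norm of `E` is Fréchet differentiable at `x` (`E` being viewed as a real space). -/
def NormFrechetDifferentiableAt (𝕜 : Type*) {E : Type*} [RCLike 𝕜] [NormedAddCommGroup E]
    [NormedSpace 𝕜 E] (x : E) : Prop :=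
  letI : NormedSpace ℝ E := NormedSpace.restrictScalars ℝ 𝕜 E
  DifferentiableAt ℝ (fun z : E => ‖z‖) x

end

/-! View `T` as the bilinear form `T x y`. The operator `T.flip : Y → X*` has the same norm, and if
`T.flip` attains its norm at `s` while the functional `T.flip s` attains its norm at `x`, then `T`
attains its norm at `x`. So it suffices to produce such an `s` and to control `T.flip s`.

The RNP produces `s`. A Stegall type variational principle (`HasRNP.exists_small_perturbation`),
applied to the closed convex hull of the graph of `y ↦ ‖S y‖` over the unit ball, shows that
arbitrarily small rank one perturbations of `S = T.flip` have near-maximizers clustered around one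
orbit of rotations (`HasRNP.exists_add_smulRight_mem`). This clustering is an open condition, so for
residually many `T` in `I` it holds at every scale, and `T.flip` absolutely strongly exposes the
ball at some point, which is then a strongly exposed point of the ball.

Countability controls `T.flip s`. Up to a rotation, `s` lies in a fixed countable set. For each
nonzero `s` in it, `T ↦ T.flip s` is an open surjection from `I` onto `X*`, so it pulls residual
sets back to residual sets. Hence, for residually many `T`, all these functionals lie in a
prescribed residual set: the norm attaining ones for (a), the absolutely strongly exposing ones for
(b). In (b) the form then peaks, up to rotations, at a single pair `(x₀, s)`, and a Šmulyan type
estimate gives Fréchet differentiability. -/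

/-! ### Variational principles on convex subsets of `E × ℝ` -/

section RealBanach

variable {E : Type*} [NormedAddCommGroup E] [NormedSpace ℝ E]

/-- A form of Ekeland's variational principle for a functional `(y, t) ↦ f y + t` on a closed
subset of `E × ℝ`; the perturbation only depends on the first coordinate. -/
theorem exists_ekeland_point [CompleteSpace E] {C : Set (E × ℝ)} (hC : IsClosed C)
    (f : StrongDual ℝ E) {M : ℝ} (hM : ∀ z ∈ C, f z.1 + z.2 ≤ M) {δ : ℝ} (hδ : 0 < δ)
    {z₁ : E × ℝ} (hz₁ : z₁ ∈ C) :
    ∃ z' ∈ C, f z₁.1 + z₁.2 + δ * ‖z'.1 - z₁.1‖ ≤ f z'.1 + z'.2 ∧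
      ∀ w ∈ C, f w.1 + w.2 ≤ f z'.1 + z'.2 + δ * ‖w.1 - z'.1‖ := by
  set h : E × ℝ → ℝ := fun z => f z.1 + z.2 with hh
  have hcont : Continuous h := by fun_prop
  -- Among the points of `C` that improve on `z` by at least `δ` times the distance of first
  -- coordinates, pick one within `(1 / 2) ^ n` of the best.
  have step : ∀ (n : ℕ) (z : C), ∃ w : C, h z + δ * ‖w.1.1 - z.1.1‖ ≤ h w ∧
      ∀ v ∈ C, h z + δ * ‖v.1 - z.1.1‖ ≤ h v → h v ≤ h w + (1 / 2) ^ n := by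
    intro n z
    have hne : (h '' {v ∈ C | h z + δ * ‖v.1 - z.1.1‖ ≤ h v}).Nonempty :=
      ⟨h z, z, ⟨z.2, by simp⟩, rfl⟩
    have hbdd : BddAbove (h '' {v ∈ C | h z + δ * ‖v.1 - z.1.1‖ ≤ h v}) := by
      refine ⟨M, ?_⟩
      rintro _ ⟨v, hv, rfl⟩
      exact hM v hv.1
    have hp : (0 : ℝ) < (1 / 2) ^ n := by positivity
    obtain ⟨_, ⟨w, hw, rfl⟩, hlt⟩ := exists_lt_of_lt_csSup hne (sub_lt_self _ hp)
    refine ⟨⟨w, hw.1⟩, hw.2, fun v hv hvz => ?_⟩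
    have := le_csSup hbdd ⟨v, ⟨hv, hvz⟩, rfl⟩
    simp only
    linarith
  choose next hnext₁ hnext₂ using step
  let s : ℕ → C := fun n => Nat.rec ⟨z₁, hz₁⟩ (fun n z => next n z) n
  have hs : ∀ n, s (n + 1) = next n (s n) := fun n => rfl
  have hmono : ∀ n k : ℕ, h (s n).1 + δ * ‖(s (n + k)).1.1 - (s n).1.1‖ ≤ h (s (n + k)).1 := by
    intro n k
    induction k with
    | zero => simp
    | succ k ih =>
      have h1 := hnext₁ (n + k) (s (n + k))
      rw [← hs] at h1
      have h2 := norm_sub_le_norm_sub_add_norm_sub (s (n + (k + 1))).1.1 (s (n + k)).1.1 (s n).1.1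
      have h3 := mul_le_mul_of_nonneg_left h2 hδ.le
      rw [← add_assoc] at h3 ⊢
      linarith
  have hm : Monotone fun n => h (s n).1 := by
    refine monotone_nat_of_le_succ fun n => ?_
    have := hmono n 1
    nlinarith [norm_nonneg ((s (n + 1)).1.1 - (s n).1.1)]
  have hb : BddAbove (Set.range fun n => h (s n).1) := ⟨M, by rintro _ ⟨n, rfl⟩; exact hM _ (s n).2⟩
  have hlim := tendsto_atTop_ciSup hm hb
  set L := ⨆ n, h (s n).1
  have hle : ∀ n, h (s n).1 ≤ L := fun n => le_ciSup hb n
  have hcau : CauchySeq fun n => (s n).1.1 := by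
    refine cauchySeq_of_le_tendsto_0 (fun n => 2 * (L - h (s n).1) / δ) (fun n m N hn hm' => ?_) ?_
    · have key : ∀ n, N ≤ n → dist (s n).1.1 (s N).1.1 ≤ (L - h (s N).1) / δ := by
        intro n hn
        obtain ⟨k, rfl⟩ := Nat.exists_eq_add_of_le hn
        rw [dist_eq_norm, le_div_iff₀ hδ]
        linarith [hmono N k, hle (N + k)]
      calc _ ≤ dist (s n).1.1 (s N).1.1 + dist (s m).1.1 (s N).1.1 := dist_triangle_right _ _ _
        _ ≤ (L - h (s N).1) / δ + (L - h (s N).1) / δ := add_le_add (key n hn) (key m hm')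
        _ = _ := by ring
    · have : Tendsto (fun n => 2 * (L - h (s n).1) / δ) atTop (𝓝 (2 * (L - L) / δ)) :=
        ((tendsto_const_nhds.sub hlim).const_mul 2).div_const δ
      simpa using this
  obtain ⟨y', hy'⟩ := cauchySeq_tendsto_of_complete hcau
  -- The penalty ignores second coordinates; they converge because they equal `h - f`, and both
  -- terms converge.
  have hsnd : Tendsto (fun n => (s n).1.2) atTop (𝓝 (L - f y')) := by
    have := hlim.sub ((f.continuous.tendsto y').comp hy')
    refine this.congr fun n => ?_
    simp [hh]
  have hz' : Tendsto (fun n => (s n).1) atTop (𝓝 (y', L - f y')) := hy'.prodMk_nhds hsnd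
  have hz'C : (y', L - f y') ∈ C := hC.mem_of_tendsto hz' (Eventually.of_forall fun n => (s n).2)
  have hhz' : h (y', L - f y') = L := by simp [hh]
  have hreach : ∀ n, h (s n).1 + δ * ‖y' - (s n).1.1‖ ≤ L := by
    intro n
    refine le_of_tendsto_of_tendsto (b := atTop)
      (f := fun m => h (s n).1 + δ * ‖(s m).1.1 - (s n).1.1‖) (g := fun m => h (s m).1) ?_ hlim ?_
    · exact tendsto_const_nhds.add ((hy'.sub tendsto_const_nhds).norm.const_mul δ)
    · filter_upwards [eventually_ge_atTop n] with m hm'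
      obtain ⟨k, rfl⟩ := Nat.exists_eq_add_of_le hm'
      exact hmono n k
  refine ⟨(y', L - f y'), hz'C, ?_, ?_⟩
  · have h0 := hreach 0
    rw [← hhz'] at h0
    exact h0
  · intro w hw
    by_contra! hcon
    change h (y', L - f y') + δ * ‖w.1 - y'‖ < h w at hcon
    rw [hhz'] at hcon
    -- A point violating the conclusion is a competitor at every stage of the construction, so `h w`
    -- cannot exceed the limit `L`.
    have hwL : ∀ n, h w ≤ L + (1 / 2) ^ n := by
      intro n
      have h1 := hnext₂ n (s n) w hw ?_
      · rw [← hs] at h1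
        linarith [hle (n + 1)]
      · have h2 := norm_sub_le_norm_sub_add_norm_sub w.1 y' (s n).1.1
        have h3 := mul_le_mul_of_nonneg_left h2 hδ.le
        linarith [hreach n]
    have h0 : h w ≤ L := by
      refine ge_of_tendsto (x := atTop) (f := fun n : ℕ => L + (1 / 2 : ℝ) ^ n) ?_
        (Eventually.of_forall hwL)
      simpa using (tendsto_const_nhds (x := L)).add
        (tendsto_pow_atTop_nhds_zero_of_lt_one (r := (1 / 2 : ℝ)) (by norm_num) (by norm_num))
    nlinarith [norm_nonneg (w.1 - y')]

/-- A functional bounded by `δ ‖·‖` on a convex set, up to translation, is dominated there by a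
linear functional of norm at most `δ`. -/
theorem exists_norm_le_of_le_norm_sub {C : Set (E × ℝ)} (hconv : Convex ℝ C)
    (f : StrongDual ℝ E) {δ : ℝ} (hδ : 0 < δ) {z' : E × ℝ} (hz' : z' ∈ C)
    (hmax : ∀ w ∈ C, f w.1 + w.2 ≤ f z'.1 + z'.2 + δ * ‖w.1 - z'.1‖) :
    ∃ e : StrongDual ℝ E, ‖e‖ ≤ δ ∧
      ∀ w ∈ C, f w.1 + w.2 - (f z'.1 + z'.2) ≤ e (w.1 - z'.1) := by
  -- The hypothesis says that `C`, sheared by `(y, t) ↦ (y, f y + t)` and translated so that `z'`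
  -- goes to the origin, misses the open convex cone `A`. A separating hyperplane is the graph of
  -- the required functional.
  let A : Set (E × ℝ) := {p | δ * ‖p.1‖ < p.2}
  have hAo : IsOpen A := isOpen_lt (by fun_prop) (by fun_prop)
  have hAc : Convex ℝ A := by
    intro p hp q hq a b ha hb hab
    have hp' : δ * ‖p.1‖ < p.2 := hp
    have hq' : δ * ‖q.1‖ < q.2 := hq
    change δ * ‖a • p.1 + b • q.1‖ < a * p.2 + b * q.2
    have h1 : ‖a • p.1 + b • q.1‖ ≤ a * ‖p.1‖ + b * ‖q.1‖ := by
      refine (norm_add_le _ _).trans ?_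
      rw [norm_smul, norm_smul, Real.norm_of_nonneg ha, Real.norm_of_nonneg hb]
    have h2 := mul_le_mul_of_nonneg_left h1 hδ.le
    rcases eq_or_lt_of_le ha with rfl | ha'
    · have : b = 1 := by linarith
      subst this
      linarith
    · have h3 := mul_lt_mul_of_pos_left hp' ha'
      have h4 := mul_le_mul_of_nonneg_left hq'.le hb
      linarith
  let T : E × ℝ →ₗ[ℝ] E × ℝ :=
    (LinearMap.fst ℝ E ℝ).prod ((f : E →ₗ[ℝ] ℝ).comp (LinearMap.fst ℝ E ℝ) + LinearMap.snd ℝ E ℝ)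
  have hT : ∀ w, T w = (w.1, f w.1 + w.2) := fun w => rfl
  have hBc : Convex ℝ ((fun p => -T z' + p) '' (T '' C)) := (hconv.linear_image T).translate _
  have hdisj : Disjoint A ((fun p => -T z' + p) '' (T '' C)) := by
    rw [Set.disjoint_left]
    rintro _ hpA ⟨_, ⟨w, hw, rfl⟩, rfl⟩
    have h1 : δ * ‖-z'.1 + w.1‖ < -(f z'.1 + z'.2) + (f w.1 + w.2) := hpA
    rw [neg_add_eq_sub] at h1
    linarith [hmax w hw]
  obtain ⟨g, u, hgA, hgB⟩ := geometric_hahn_banach_open hAc hAo hBc hdisj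
  have hu0 : u ≤ 0 := by
    have := hgB 0 ⟨T z', ⟨z', hz', rfl⟩, by simp⟩
    simpa using this
  set k : ℝ := g (0, 1) with hk
  have hsplit : ∀ v r, g (v, r) = g (v, 0) + r * k := by
    intro v r
    have : ((v, r) : E × ℝ) = (v, 0) + r • ((0 : E), (1 : ℝ)) := by simp
    rw [this, map_add, map_smul, smul_eq_mul]
  have hk0 : k < 0 := (hgA (0, 1) (by simp [A])).trans_le hu0
  -- If `u < 0`, then `(0, u / k)` lies in the cone and `g` takes the value `u` there, against the
  -- strict inequality on `A`.
  have hu : 0 ≤ u := by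
    by_contra! hcon
    have h1 := hgA (0, u / k) (by
      simp only [A, Set.mem_ofPred_eq, norm_zero, mul_zero]
      exact div_pos_of_neg_of_neg hcon hk0)
    rw [hsplit, div_mul_cancel₀ _ hk0.ne] at h1
    have : g ((0 : E), (0 : ℝ)) = 0 := g.map_zero
    linarith
  have hbound : ∀ v, g (v, 0) ≤ -k * (δ * ‖v‖) := by
    intro v
    refine le_of_forall_pos_le_add fun ε hε => ?_
    have h1 := hgA (v, δ * ‖v‖ + ε / -k) (by
      simp only [A, Set.mem_ofPred_eq, lt_add_iff_pos_right]
      exact div_pos hε (by linarith))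
    rw [hsplit, add_mul, div_neg, neg_mul, div_mul_cancel₀ _ hk0.ne] at h1
    linarith
  let g₀ : StrongDual ℝ E := g.comp (ContinuousLinearMap.inl ℝ E ℝ)
  have hg₀ : ∀ v, g₀ v = g (v, 0) := fun v => rfl
  refine ⟨(-k)⁻¹ • g₀, ?_, fun w hw => ?_⟩
  · refine ContinuousLinearMap.opNorm_le_bound _ hδ.le fun v => ?_
    have hkk : 0 < -k := by linarith
    rw [_root_.smul_apply, smul_eq_mul, Real.norm_eq_abs, abs_mul,
      abs_of_pos (inv_pos.2 hkk), inv_mul_le_iff₀ hkk, abs_le]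
    have h1 := hbound v
    have h2 := hbound (-v)
    rw [← hg₀] at h1 h2
    rw [map_neg, norm_neg] at h2
    constructor <;> linarith
  · have h1 := hgB _ ⟨T w, ⟨w, hw, rfl⟩, rfl⟩
    have h2 : (fun p => -T z' + p) (T w) = (w.1 - z'.1, f w.1 + w.2 - (f z'.1 + z'.2)) := by
      simp only [neg_add_eq_sub, hT]
      rfl
    rw [h2, hsplit, ← hg₀] at h1
    have hkk : 0 < -k := by linarith
    rw [_root_.smul_apply, smul_eq_mul, le_inv_mul_iff₀ hkk]
    linarith

/-- Brøndsted–Rockafellar type theorem: close to a near maximizer of `f y + t` on a closed convex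
set there is a maximizer for a functional close to `f`. -/
theorem exists_isMax_near [CompleteSpace E] {C : Set (E × ℝ)} (hC : IsClosed C)
    (hconv : Convex ℝ C) (f : StrongDual ℝ E) {δ : ℝ} (hδ : 0 < δ) {z₁ : E × ℝ} (hz₁ : z₁ ∈ C)
    (hmax : ∀ z ∈ C, f z.1 + z.2 ≤ f z₁.1 + z₁.2 + δ * δ) :
    ∃ z' ∈ C, ∃ f' : StrongDual ℝ E, ‖f' - f‖ ≤ δ ∧ ‖z'.1 - z₁.1‖ ≤ δ ∧
      ∀ z ∈ C, f' z.1 + z.2 ≤ f' z'.1 + z'.2 := by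
  obtain ⟨z', hz', h1, h2⟩ := exists_ekeland_point hC f hmax hδ hz₁
  obtain ⟨e, he, h3⟩ := exists_norm_le_of_le_norm_sub hconv f hδ hz' h2
  refine ⟨z', hz', f - e, by simpa using he, ?_, fun z hz => ?_⟩
  · have := hmax z' hz'
    exact le_of_mul_le_mul_left (by linarith) hδ
  · have := h3 z hz
    rw [map_sub] at this
    simp only [_root_.sub_apply]
    linarith

/-- In a space with the Radon-Nikodym property, a small linear perturbation makes the near
maximizers of a bounded closed convex subset of `E × ℝ` close to each other. -/
theorem HasRNP.exists_small_perturbation [CompleteSpace E] (hE : HasRNP ℝ E) {C : Set (E × ℝ)}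
    (hne : C.Nonempty) (hC : IsClosed C) (hconv : Convex ℝ C) {R : ℝ} (hR : 0 < R)
    (hbdd : ∀ z ∈ C, ‖z.1‖ ≤ R ∧ z.2 ≤ R) {η ε : ℝ} (hη : 0 < η) (hε : 0 < ε) :
    ∃ (φ : StrongDual ℝ E) (α : ℝ), ‖φ‖ < η ∧ 0 < α ∧ ∀ z₁ ∈ C, ∀ z₂ ∈ C,
      (∀ z ∈ C, φ z.1 + z.2 ≤ φ z₁.1 + z₁.2 + α) →
      (∀ z ∈ C, φ z.1 + z.2 ≤ φ z₂.1 + z₂.2 + α) → ‖z₁.1 - z₂.1‖ ≤ ε := by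
  -- Dentability is applied to the exact maximizers of all perturbations of size less than `η`.
  let A : Set E := {y | ∃ (t : ℝ) (f : StrongDual ℝ E), ‖f‖ < η ∧ (y, t) ∈ C ∧
    ∀ z ∈ C, f z.1 + z.2 ≤ f y + t}
  have hAne : A.Nonempty := by
    have hbd : BddAbove (Prod.snd '' C) := ⟨R, by rintro _ ⟨z, hz, rfl⟩; exact (hbdd z hz).2⟩
    obtain ⟨_, ⟨z₁, hz₁, rfl⟩, hlt⟩ := exists_lt_of_lt_csSup (hne.image Prod.snd)
      (sub_lt_self _ (by positivity : 0 < η / 2 * (η / 2)))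
    obtain ⟨z', hz', f', hf', -, hmax⟩ := exists_isMax_near hC hconv 0 (half_pos hη) hz₁
      (fun z hz => by
        have := le_csSup hbd ⟨z, hz, rfl⟩
        simp only [_root_.zero_apply, zero_add]
        linarith)
    exact ⟨z'.1, z'.2, f', by rw [sub_zero] at hf'; linarith, hz', hmax⟩
  have hAbdd : Bornology.IsBounded A := by
    refine isBounded_iff_forall_norm_le.2 ⟨R, ?_⟩
    rintro y ⟨t, -, -, hy, -⟩
    exact (hbdd _ hy).1
  obtain ⟨x, β, hβ, hdiam⟩ := hE A hAne hAbdd (ε / 3) (by positivity)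
  obtain ⟨_, ⟨y, hyA, rfl⟩, hy⟩ := exists_lt_of_lt_csSup (hAne.image fun z => RCLike.re (x z))
    (sub_lt_self _ hβ)
  set q := sSup ((fun z => RCLike.re (x z)) '' A)
  obtain ⟨t, f, hfη, hyC, hymax⟩ := hyA
  have hy' : q - β < x y := hy
  have hslice : ∀ y ∈ A, q - β < x y → y ∈ slice A x β := fun y hy h => ⟨hy, h⟩
  -- Tilting `f` slightly in the direction `x` pushes near-maximizers into the slice, while the norm
  -- stays below `η`.
  obtain ⟨r, hr, hrη⟩ : ∃ r > 0, ‖f‖ + r * ‖x‖ < η := by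
    refine ⟨(η - ‖f‖) / (2 * (‖x‖ + 1)), by
      have := norm_nonneg x
      have : 0 < η - ‖f‖ := by linarith
      positivity, ?_⟩
    have hx := norm_nonneg x
    have h1 : (η - ‖f‖) / (2 * (‖x‖ + 1)) * ‖x‖ ≤ (η - ‖f‖) / 2 := by
      rw [div_mul_eq_mul_div, div_le_div_iff₀ (by positivity) (by positivity)]
      nlinarith
    linarith
  have hf₁ : ‖f + r • x‖ < η := by
    refine (norm_add_le _ _).trans_lt ?_
    rwa [norm_smul, Real.norm_of_nonneg hr.le]
  set σ := x y - (q - β) with hσ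
  have hσ0 : 0 < σ := by simp only [hσ]; linarith
  -- The three bounds keep functionals `δ`-close to `f + r • x` admissible for `A`, keep points near
  -- the slice within `ε / 3` of it, and make the error in the monotonicity estimate below smaller
  -- than the gain `r * σ`.
  obtain ⟨δ, hδ, hδ1, hδ2, hδ3⟩ : ∃ δ > 0, δ < η - ‖f + r • x‖ ∧ δ ≤ ε / 3 ∧
      δ * (2 * R) < r * σ := by
    have h3 : 0 < r * σ / (2 * R) := by positivity
    have h1 : 0 < η - ‖f + r • x‖ := by linarith
    have h2 : 0 < ε / 3 := by positivity
    refine ⟨min (min (η - ‖f + r • x‖) (ε / 3)) (r * σ / (2 * R)) / 2, by positivity, ?_, ?_, ?_⟩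
    · have := (min_le_left (min (η - ‖f + r • x‖) (ε / 3)) (r * σ / (2 * R))).trans
        (min_le_left _ _)
      linarith
    · have := (min_le_left (min (η - ‖f + r • x‖) (ε / 3)) (r * σ / (2 * R))).trans
        (min_le_right _ _)
      linarith
    · have := min_le_right (min (η - ‖f + r • x‖) (ε / 3)) (r * σ / (2 * R))
      rw [← lt_div_iff₀ (by positivity)]
      linarith
  have key : ∀ z₁ ∈ C, (∀ z ∈ C, (f + r • x) z.1 + z.2 ≤ (f + r • x) z₁.1 + z₁.2 + δ * δ) →
      ∃ y' ∈ slice A x β, ‖y' - z₁.1‖ ≤ δ := by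
    intro z₁ hz₁ hmax
    obtain ⟨z', hz', f', hf', hd, hmax'⟩ := exists_isMax_near hC hconv _ hδ hz₁ hmax
    refine ⟨z'.1, hslice _ ⟨z'.2, f', ?_, hz', hmax'⟩ ?_, hd⟩
    · have := norm_le_norm_add_norm_sub' f' (f + r • x)
      linarith
    -- Monotonicity: adding the maximality of `y` for `f` and of `z'` for `f'` gives `(f' - f) (z'.1
    -- - y) ≥ 0`. As `f'` is `δ`-close to `f + r • x`, the value `x z'.1` cannot fall `σ` below `x
    -- y`.
    · have h1 := hymax z' hz'
      have h2 := hmax' _ hyC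
      have h3 : (f' - (f + r • x)) (z'.1 - y) ≤ δ * (2 * R) := by
        refine (le_abs_self _).trans (((f' - (f + r • x)).le_opNorm _).trans ?_)
        refine mul_le_mul hf' ?_ (norm_nonneg _) hδ.le
        have := norm_sub_le z'.1 y
        linarith [(hbdd _ hz').1, (hbdd _ hyC).1]
      simp only [_root_.sub_apply, _root_.add_apply,
        _root_.smul_apply, map_sub, smul_eq_mul] at h3
      simp only at h2
      have h4 : r * (x y - x z'.1) < r * σ := by nlinarith
      have := lt_of_mul_lt_mul_left h4 hr.le
      simp only [hσ] at this
      linarith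
  refine ⟨f + r • x, δ * δ, hf₁, by positivity, fun z₁ hz₁ z₂ hz₂ h₁ h₂ => ?_⟩
  obtain ⟨y₁, hy₁, hd₁⟩ := key z₁ hz₁ h₁
  obtain ⟨y₂, hy₂, hd₂⟩ := key z₂ hz₂ h₂
  have hd : dist y₁ y₂ < ε / 3 :=
    (dist_le_diam_of_mem (hAbdd.subset fun _ h => h.1) hy₁ hy₂).trans_lt hdiam
  rw [← dist_eq_norm] at hd₁ hd₂ ⊢
  have h1 := dist_triangle z₁.1 y₁ z₂.1
  have h2 := dist_triangle y₁ y₂ z₂.1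
  rw [dist_comm] at hd₁
  linarith

end RealBanach

/-! ### Operators that absolutely strongly expose the unit ball -/

section Operators

variable {𝕜 E W : Type*} [RCLike 𝕜] [NormedAddCommGroup E] [NormedSpace 𝕜 E]
  [NormedAddCommGroup W] [NormedSpace 𝕜 W]

theorem HasRNP.restrictScalars_real [NormedSpace ℝ E] [IsScalarTower ℝ 𝕜 E] (h : HasRNP 𝕜 E) :
    HasRNP ℝ E := by
  intro D hD hD' ε hε
  obtain ⟨f, α, hα, hd⟩ := h D hD hD' ε hε
  exact ⟨RCLike.reCLM.comp (f.restrictScalars ℝ), α, hα, hd⟩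

/-- The points of the unit ball at which `S` almost attains its norm are close to one orbit under
rotations. -/
def nearlyStronglyExposing (𝕜 E W : Type*) [RCLike 𝕜] [NormedAddCommGroup E] [NormedSpace 𝕜 E]
    [NormedAddCommGroup W] [NormedSpace 𝕜 W] (ε : ℝ) : Set (E →L[𝕜] W) :=
  {S | ∃ y₀ : E, ∃ α > 0, ∀ y, ‖y‖ ≤ 1 → ‖S‖ - α < ‖S y‖ → ∃ θ : 𝕜, ‖θ‖ = 1 ∧ ‖θ • y - y₀‖ ≤ ε}

/-- `S` absolutely strongly exposes the unit ball at `y₀`. -/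
def AbsStronglyExposesAt (S : E →L[𝕜] W) (y₀ : E) : Prop :=
  ‖y₀‖ ≤ 1 ∧ ∀ ε > 0, ∃ α > 0, ∀ y, ‖y‖ ≤ 1 → ‖S‖ - α < ‖S y‖ →
    ∃ θ : 𝕜, ‖θ‖ = 1 ∧ ‖θ • y - y₀‖ ≤ ε

theorem isOpen_nearlyStronglyExposing (ε : ℝ) : IsOpen (nearlyStronglyExposing 𝕜 E W ε) := by
  rw [Metric.isOpen_iff]
  rintro S ⟨y₀, α, hα, h⟩
  refine ⟨α / 3, by positivity, fun S' hS' => ⟨y₀, α / 3, by positivity, fun y hy hy' => ?_⟩⟩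
  rw [mem_ball, dist_eq_norm] at hS'
  refine h y hy ?_
  have h1 := norm_le_norm_add_norm_sub' S S'
  rw [norm_sub_rev] at h1
  have h2 : ‖S' y‖ ≤ ‖S y‖ + ‖S' - S‖ := by
    have h3 := norm_le_norm_add_norm_sub' (S' y) (S y)
    have h4 : ‖S' y - S y‖ ≤ ‖S' - S‖ := (S' - S).unit_le_opNorm y hy
    linarith
  linarith

/-- Near-maximizers at scale `n` are within `2 * (1 / 2) ^ n` of each other up to a rotation.
Accumulating these rotations along a norming sequence makes it Cauchy, and its limit is the exposed
point. -/
theorem exists_absStronglyExposesAt [CompleteSpace E] {S : E →L[𝕜] W}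
    (h : ∀ n : ℕ, S ∈ nearlyStronglyExposing 𝕜 E W ((1 / 2) ^ n)) :
    ∃ y₀, AbsStronglyExposesAt S y₀ := by
  choose y α hα hy using h
  have hw : ∀ n, ∃ w : E, ‖w‖ ≤ 1 ∧ ∀ k ≤ n, ‖S‖ - α k < ‖S w‖ := by
    intro n
    obtain ⟨β, hβ, hβα⟩ : ∃ β > 0, ∀ k ≤ n, β ≤ α k := by
      induction n with
      | zero => exact ⟨α 0, hα 0, by simp⟩
      | succ n ih =>
        obtain ⟨β, hβ, h⟩ := ih
        refine ⟨min β (α (n + 1)), lt_min hβ (hα _), fun k hk => ?_⟩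
        rcases Nat.le_succ_iff.1 hk with hk | rfl
        · exact (min_le_left _ _).trans (h k hk)
        · exact min_le_right _ _
    obtain ⟨w, hw, hw'⟩ := S.exists_lt_apply_of_lt_opNorm (sub_lt_self _ hβ)
    exact ⟨w, hw.le, fun k hk => by linarith [hβα k hk]⟩
  choose w hw1 hwα using hw
  have hpair : ∀ n a b, ‖a‖ ≤ 1 → ‖b‖ ≤ 1 → ‖S‖ - α n < ‖S a‖ → ‖S‖ - α n < ‖S b‖ →
      ∃ θ : 𝕜, ‖θ‖ = 1 ∧ ‖θ • a - b‖ ≤ 2 * (1 / 2) ^ n := by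
    intro n a b ha hb ha' hb'
    obtain ⟨θ, hθ, h1⟩ := hy n a ha ha'
    obtain ⟨η, hη, h2⟩ := hy n b hb hb'
    have hη0 : η ≠ 0 := norm_ne_zero_iff.1 (by rw [hη]; exact one_ne_zero)
    refine ⟨η⁻¹ * θ, by rw [norm_mul, norm_inv, hη, hθ]; simp, ?_⟩
    have h3 : (η⁻¹ * θ) • a - b = η⁻¹ • ((θ • a - y n) - (η • b - y n)) := by
      rw [sub_sub_sub_cancel_right, smul_sub, smul_smul, smul_smul, inv_mul_cancel₀ hη0, one_smul]
    rw [h3, norm_smul, norm_inv, hη, inv_one, one_mul]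
    linarith [norm_sub_le (θ • a - y n) (η • b - y n)]
  choose θ hθ hθw using fun n => hpair n (w (n + 1)) (w n) (hw1 _) (hw1 _)
    (hwα (n + 1) n n.le_succ) (hwα n n le_rfl)
  -- Each `θ n` only aligns `w (n + 1)` with `w n`; the products `c n` align the whole sequence at
  -- once.
  let c : ℕ → 𝕜 := fun n => Nat.rec 1 (fun n z => z * θ n) n
  have hcs : ∀ n, c (n + 1) = c n * θ n := fun n => rfl
  have hc : ∀ n, ‖c n‖ = 1 := by
    intro n
    induction n with
    | zero => simp [c]
    | succ n ih => rw [hcs, norm_mul, ih, hθ, one_mul]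
  have hv1 : ∀ n, ‖c n • w n‖ ≤ 1 := fun n => by rw [norm_smul, hc, one_mul]; exact hw1 n
  have hvα : ∀ n, ∀ k ≤ n, ‖S‖ - α k < ‖S (c n • w n)‖ := fun n k hk => by
    rw [map_smul, norm_smul, hc, one_mul]; exact hwα n k hk
  have hcau : CauchySeq fun n => c n • w n := by
    refine cauchySeq_of_le_geometric_two (C := 4) fun n => ?_
    rw [dist_comm, dist_eq_norm, hcs, mul_smul, ← smul_sub, norm_smul, hc, one_mul]
    refine (hθw n).trans (le_of_eq ?_)
    rw [div_pow, one_pow]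
    ring
  obtain ⟨y₀, hy₀⟩ := cauchySeq_tendsto_of_complete hcau
  refine ⟨y₀, le_of_tendsto' hy₀.norm hv1, fun ε hε => ?_⟩
  obtain ⟨n, hn⟩ := exists_pow_lt_of_lt_one (show 0 < ε / 4 by positivity)
    (show (1 / 2 : ℝ) < 1 by norm_num)
  refine ⟨α n, hα n, fun a ha ha' => ?_⟩
  obtain ⟨m, hm, hmn⟩ := ((hy₀.eventually (ball_mem_nhds y₀ (half_pos hε))).and
    (eventually_ge_atTop n)).exists
  obtain ⟨η, hη, h1⟩ := hpair n a _ ha (hv1 m) ha' (hvα m n hmn)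
  refine ⟨η, hη, ?_⟩
  rw [dist_eq_norm] at hm
  linarith [norm_sub_le_norm_sub_add_norm_sub (η • a) (c m • w m) y₀]

theorem AbsStronglyExposesAt.smul {S : E →L[𝕜] W} {y₀ : E} (h : AbsStronglyExposesAt S y₀)
    {c : 𝕜} (hc : ‖c‖ = 1) : AbsStronglyExposesAt S (c • y₀) := by
  refine ⟨by rw [norm_smul, hc, one_mul]; exact h.1, fun ε hε => ?_⟩
  obtain ⟨α, hα, h'⟩ := h.2 ε hε
  refine ⟨α, hα, fun y hy hy' => ?_⟩
  obtain ⟨θ, hθ, hd⟩ := h' y hy hy'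
  refine ⟨c * θ, by rw [norm_mul, hc, hθ, one_mul], ?_⟩
  rwa [mul_smul, ← smul_sub, norm_smul, hc, one_mul]

theorem AbsStronglyExposesAt.exists_rotation {S : E →L[𝕜] W} {y₀ : E}
    (h : AbsStronglyExposesAt S y₀) {ι : Type*} {l : Filter ι} {u : ι → E}
    (hu : ∀ᶠ i in l, ‖u i‖ ≤ 1) (hS : Tendsto (fun i => ‖S (u i)‖) l (𝓝 ‖S‖)) :
    ∃ θ : ι → 𝕜, (∀ i, ‖θ i‖ = 1) ∧ Tendsto (fun i => θ i • u i) l (𝓝 y₀) := by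
  -- The definition gives a rotation depending on `ε`. The best rotation, which exists by
  -- compactness of the unit sphere of `𝕜`, serves every `ε`.
  have hmin : ∀ i, ∃ θ : 𝕜, ‖θ‖ = 1 ∧ ∀ η : 𝕜, ‖η‖ = 1 → ‖θ • u i - y₀‖ ≤ ‖η • u i - y₀‖ := by
    intro i
    obtain ⟨θ, hθ, hm⟩ := (isCompact_sphere (0 : 𝕜) 1).exists_isMinOn ⟨1, by simp⟩
      (f := fun η : 𝕜 => ‖η • u i - y₀‖) (by fun_prop)
    exact ⟨θ, by simpa using hθ, fun η hη => hm (by simpa using hη)⟩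
  choose θ hθ hm using hmin
  refine ⟨θ, hθ, ?_⟩
  rw [tendsto_iff_norm_sub_tendsto_zero, NormedAddGroup.tendsto_nhds_zero]
  intro ε hε
  obtain ⟨α, hα, h'⟩ := h.2 (ε / 2) (half_pos hε)
  filter_upwards [hu, hS.eventually (lt_mem_nhds (sub_lt_self _ hα))] with i hi hi'
  obtain ⟨η, hη, hd⟩ := h' _ hi hi'
  rw [norm_norm]
  linarith [hm i η hη]

/-- `S` attains its norm at `y₀`. -/
theorem AbsStronglyExposesAt.norm_apply {S : E →L[𝕜] W} {y₀ : E}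
    (h : AbsStronglyExposesAt S y₀) : ‖S y₀‖ = ‖S‖ := by
  refine le_antisymm (S.unit_le_opNorm _ h.1) (le_of_forall_pos_le_add fun ε hε => ?_)
  have hd : 0 < ε / (2 * (‖S‖ + 1)) := by positivity
  obtain ⟨α, hα, h'⟩ := h.2 _ hd
  obtain ⟨y, hy, hy'⟩ := S.exists_lt_apply_of_lt_opNorm
    (sub_lt_self ‖S‖ (lt_min hα (half_pos hε)))
  obtain ⟨θ, hθ, hθy⟩ := h' y hy.le (by linarith [min_le_left α (ε / 2)])
  have h1 : ‖S (θ • y) - S y₀‖ ≤ ε / 2 := by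
    rw [← map_sub]
    refine (S.le_opNorm_of_le hθy).trans ?_
    rw [mul_div_assoc', div_le_div_iff₀ (by positivity) (by positivity)]
    nlinarith [norm_nonneg S]
  have h2 : ‖S (θ • y)‖ = ‖S y‖ := by rw [map_smul, norm_smul, hθ, one_mul]
  linarith [norm_le_norm_add_norm_sub' (S (θ • y)) (S y₀), min_le_right α (ε / 2)]

/-- For the zero operator every point of the ball is a near-maximizer, but no orbit of rotations is
close both to `0` and to a unit vector. -/
theorem AbsStronglyExposesAt.ne_zero [Nontrivial E] {S : E →L[𝕜] W} {y₀ : E}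
    (h : AbsStronglyExposesAt S y₀) : S ≠ 0 := by
  rintro rfl
  obtain ⟨u, hu⟩ : ∃ u : E, ‖u‖ = 1 := by
    let := NormedSpace.restrictScalars ℝ 𝕜 E
    exact exists_norm_eq E zero_le_one
  obtain ⟨α, hα, h'⟩ := h.2 (1 / 3) (by norm_num)
  obtain ⟨θ, hθ, h1⟩ := h' 0 (by simp) (by simpa using hα)
  obtain ⟨η, hη, h2⟩ := h' u hu.le (by simpa using hα)
  have h3 : ‖η • u‖ = 1 := by rw [norm_smul, hη, hu, one_mul]
  rw [smul_zero, zero_sub, norm_neg] at h1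
  linarith [norm_le_norm_add_norm_sub' (η • u) y₀]

/-- If `‖z‖ ≤ M`, then expanding the square gives `‖z - M‖ ^ 2 ≤ 2 * M * (M - re z)`. -/
theorem tendsto_ofReal_of_tendsto_re {ι : Type*} {l : Filter ι} {z : ι → 𝕜} {M : ℝ}
    (hz : ∀ᶠ i in l, ‖z i‖ ≤ M) (h : Tendsto (fun i => RCLike.re (z i)) l (𝓝 M)) :
    Tendsto z l (𝓝 (M : 𝕜)) := by
  rw [tendsto_iff_norm_sub_tendsto_zero]
  have h1 : Tendsto (fun i => Real.sqrt (2 * M * (M - RCLike.re (z i)))) l (𝓝 0) := by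
    have := ((tendsto_const_nhds (x := M)).sub h).const_mul (2 * M)
    simpa using this.sqrt
  refine squeeze_zero' (Eventually.of_forall fun i => norm_nonneg _) ?_ h1
  filter_upwards [hz] with i hi
  refine Real.le_sqrt_of_sq_le ?_
  have h2 := pow_le_pow_left₀ (norm_nonneg _) hi 2
  rw [← RCLike.normSq_eq_def', RCLike.normSq_apply] at h2
  rw [← RCLike.normSq_eq_def', RCLike.normSq_apply]
  simp only [map_sub, RCLike.ofReal_re, RCLike.ofReal_im, sub_zero]
  linarith

theorem tendsto_one_of_tendsto_mul {ι : Type*} {l : Filter ι} {z θ : ι → 𝕜} {M : 𝕜} (hM : M ≠ 0)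
    (hz : Tendsto z l (𝓝 M)) (h : Tendsto (fun i => θ i * z i) l (𝓝 M)) :
    Tendsto θ l (𝓝 1) := by
  have h1 := h.div hz hM
  rw [div_self hM] at h1
  refine h1.congr' ?_
  filter_upwards [hz.eventually_ne hM] with i hi
  exact mul_div_cancel_right₀ _ hi

/-- If `g` norms `S y₀`, then `g ∘ S` strongly exposes `y₀`: a maximizing sequence converges to `y₀`
after rotations `θ n`, and since `g (S (u n))` tends to `‖S‖ ≠ 0` both with and without the
rotations, `θ n` tends to `1`. -/
theorem AbsStronglyExposesAt.mem_stronglyExposedPoints {S : E →L[𝕜] W} (hS : S ≠ 0) {y₀ : E}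
    (h : AbsStronglyExposesAt S y₀) :
    y₀ ∈ stronglyExposedPoints 𝕜 (closedBall (0 : E) 1) := by
  obtain ⟨g, hg, hgy⟩ := exists_dual_vector'' 𝕜 (S y₀)
  rw [h.norm_apply] at hgy
  have hgS : ∀ y, ‖y‖ ≤ 1 → ‖g (S y)‖ ≤ ‖S‖ := fun y hy =>
    (g.le_of_opNorm_le hg _).trans (by rw [one_mul]; exact S.unit_le_opNorm y hy)
  have hre : RCLike.re (g (S y₀)) = ‖S‖ := by rw [hgy, RCLike.ofReal_re]
  refine ⟨g.comp S, by simpa using h.1, fun y hy => ?_, fun u hu hlim => ?_⟩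
  · change RCLike.re (g (S y)) ≤ RCLike.re (g (S y₀))
    rw [hre]
    exact (RCLike.re_le_norm _).trans (hgS y (by simpa using hy))
  · simp only [ContinuousLinearMap.comp_apply, hre] at hlim
    have hu' : ∀ n, ‖u n‖ ≤ 1 := fun n => by simpa using hu n
    have hgu := tendsto_ofReal_of_tendsto_re (Eventually.of_forall fun n => hgS _ (hu' n)) hlim
    have hSu : Tendsto (fun n => ‖S (u n)‖) atTop (𝓝 ‖S‖) := by
      refine tendsto_of_tendsto_of_tendsto_of_le_of_le hlim tendsto_const_nhds (fun n => ?_)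
        fun n => S.unit_le_opNorm _ (hu' n)
      refine (RCLike.re_le_norm _).trans ((g.le_of_opNorm_le hg _).trans (by rw [one_mul]))
    obtain ⟨θ, hθ, hθu⟩ := h.exists_rotation (Eventually.of_forall hu') hSu
    have h1 : Tendsto (fun n => θ n * g (S (u n))) atTop (𝓝 (‖S‖ : 𝕜)) := by
      rw [← hgy]
      refine (((g.comp S).continuous.tendsto y₀).comp hθu).congr fun n => ?_
      simp
    have hθ1 := tendsto_one_of_tendsto_mul (by simpa using hS) hgu h1
    have h2 := (hθ1.inv₀ one_ne_zero).smul hθu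
    rw [inv_one, one_smul] at h2
    refine h2.congr fun n => ?_
    rw [smul_smul, inv_mul_cancel₀ (norm_ne_zero_iff.1 (by rw [hθ]; exact one_ne_zero)), one_smul]

theorem StronglyExposes.re_apply_eq_norm {f : StrongDual 𝕜 E} {x₀ : E}
    (h : StronglyExposes f (closedBall (0 : E) 1) x₀) : RCLike.re (f x₀) = ‖f‖ := by
  refine le_antisymm ((RCLike.re_le_norm _).trans (f.unit_le_opNorm _ (by simpa using h.1))) ?_
  by_contra! hlt
  obtain ⟨x, hx, hx'⟩ := f.exists_lt_apply_of_lt_opNorm hlt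
  obtain ⟨c, hc, hcx⟩ := RCLike.exists_norm_eq_mul_self (f x)
  have h1 : RCLike.re (f (c • x)) ≤ RCLike.re (f x₀) :=
    h.2.1 (by simpa [norm_smul, hc] using hx.le)
  rw [map_smul, smul_eq_mul, ← hcx, RCLike.ofReal_re] at h1
  linarith

theorem stronglyExposingFunctionals_subset {ε : ℝ} (hε : 0 < ε) :
    stronglyExposingFunctionals 𝕜 E ⊆ nearlyStronglyExposing 𝕜 E 𝕜 ε := by
  rintro f ⟨x₀, hx₀⟩
  refine ⟨x₀, ?_⟩
  by_contra! hcon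
  choose y hy1 hyf hy using fun n : ℕ => hcon (1 / ((n : ℝ) + 1)) (by positivity)
  choose c hc hcf using fun n => RCLike.exists_norm_eq_mul_self (f (y n))
  have hre : ∀ n, RCLike.re (f (c n • y n)) = ‖f (y n)‖ := fun n => by
    rw [map_smul, smul_eq_mul, ← hcf, RCLike.ofReal_re]
  have hlim : Tendsto (fun n => RCLike.re (f (c n • y n))) atTop (𝓝 (RCLike.re (f x₀))) := by
    rw [hx₀.re_apply_eq_norm]
    simp only [hre]
    refine tendsto_of_tendsto_of_tendsto_of_le_of_le ?_ tendsto_const_nhds (fun n => (hyf n).le)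
      fun n => f.unit_le_opNorm _ (hy1 n)
    simpa using (tendsto_const_nhds (x := ‖f‖)).sub (tendsto_one_div_add_atTop_nhds_zero_nat (𝕜 := ℝ))
  have h1 := hx₀.2.2 _ (fun n => by simpa [norm_smul, hc] using hy1 n) hlim
  obtain ⟨n, hn⟩ := (h1.eventually (ball_mem_nhds x₀ hε)).exists
  rw [dist_eq_norm] at hn
  linarith [hy n (c n) (hc n)]

/-- In a space with the Radon-Nikodym property, every operator has small rank one perturbations
which almost absolutely strongly expose the unit ball. -/
theorem HasRNP.exists_add_smulRight_mem [CompleteSpace E] [Nontrivial W] (hE : HasRNP 𝕜 E)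
    (S : E →L[𝕜] W) {η ε : ℝ} (hη : 0 < η) (hε : 0 < ε) :
    ∃ (φ : StrongDual 𝕜 E) (w : W), ‖φ‖ < η ∧ ‖w‖ = 1 ∧
      S + φ.smulRight w ∈ nearlyStronglyExposing 𝕜 E W ε := by
  let : NormedSpace ℝ E := NormedSpace.restrictScalars ℝ 𝕜 E
  have : IsScalarTower ℝ 𝕜 E := RestrictScalars.isScalarTower ℝ 𝕜 E
  -- The function `y ↦ ‖S y‖` is convex, not concave, so its graph is replaced by the closed convex
  -- hull. Upper bounds for `f y + t` are the same on both.
  let G : Set (E × ℝ) := (fun y => (y, ‖S y‖)) '' closedBall 0 1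
  have hGsub : G ⊆ closedConvexHull ℝ G := subset_closedConvexHull
  have hGne : G.Nonempty := ⟨_, 0, by simp, rfl⟩
  have hhull : ∀ (f : StrongDual ℝ E) (m : ℝ), (∀ y, ‖y‖ ≤ 1 → f y + ‖S y‖ ≤ m) →
      ∀ z ∈ closedConvexHull ℝ G, f z.1 + z.2 ≤ m := by
    intro f m hm
    refine closedConvexHull_min (t := {z : E × ℝ | f z.1 + z.2 ≤ m}) ?_ ?_ ?_
    · rintro _ ⟨y, hy, rfl⟩
      exact hm y (by simpa using hy)
    · exact convex_halfSpace_le (f := fun z : E × ℝ => f z.1 + z.2)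
        ⟨fun x y => by simp only [Prod.fst_add, Prod.snd_add, map_add]; ring,
          fun c x => by simp only [Prod.smul_fst, Prod.smul_snd, map_smul, smul_eq_mul]; ring⟩ m
    · exact isClosed_le (by fun_prop) continuous_const
  have hbdd : ∀ z ∈ closedConvexHull ℝ G, ‖z.1‖ ≤ ‖S‖ + 1 ∧ z.2 ≤ ‖S‖ + 1 := by
    intro z hz
    refine ⟨?_, ?_⟩
    · have h1 : closedConvexHull ℝ G ⊆ {z | z.1 ∈ closedBall (0 : E) 1} := by
        refine closedConvexHull_min ?_ ?_ ?_
        · rintro _ ⟨y, hy, rfl⟩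
          exact hy
        · exact (convex_closedBall (0 : E) 1).linear_preimage (LinearMap.fst ℝ E ℝ)
        · exact isClosed_closedBall.preimage continuous_fst
      have h2 : ‖z.1‖ ≤ 1 := by simpa using h1 hz
      linarith [norm_nonneg S]
    · have := hhull 0 (‖S‖ + 1) (fun y hy => by
        simp only [_root_.zero_apply, zero_add]
        linarith [S.unit_le_opNorm y hy]) z hz
      simpa using this
  obtain ⟨φ, α, hφ, hα, hclose⟩ := hE.restrictScalars_real.exists_small_perturbation
    (hGne.mono hGsub) isClosed_closedConvexHull convex_closedConvexHull
    (by positivity : 0 < ‖S‖ + 1) hbdd hη hε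
  have hclose' : ∀ a b, ‖a‖ ≤ 1 → ‖b‖ ≤ 1 →
      (∀ y, ‖y‖ ≤ 1 → φ y + ‖S y‖ ≤ φ a + ‖S a‖ + α) →
      (∀ y, ‖y‖ ≤ 1 → φ y + ‖S y‖ ≤ φ b + ‖S b‖ + α) → ‖a - b‖ ≤ ε := fun a b ha hb h1 h2 =>
    hclose (a, ‖S a‖) (hGsub ⟨a, by simpa using ha, rfl⟩) (b, ‖S b‖)
      (hGsub ⟨b, by simpa using hb, rfl⟩) (hhull φ _ h1) (hhull φ _ h2)
  let Φ : StrongDual 𝕜 E := φ.extendRCLike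
  have hΦre : ∀ y, RCLike.re (Φ y) = φ y := fun y => StrongDual.re_extendRCLike_apply φ y
  have hΦ : ‖Φ‖ = ‖φ‖ := φ.norm_extendRCLike
  obtain ⟨y₀, hy₀, hy₀max⟩ : ∃ y₀, ‖y₀‖ ≤ 1 ∧
      ∀ y, ‖y‖ ≤ 1 → φ y + ‖S y‖ ≤ φ y₀ + ‖S y₀‖ + α / 2 := by
    let D : Set ℝ := (fun y => φ y + ‖S y‖) '' closedBall 0 1
    have hD : D.Nonempty := ⟨_, 0, by simp, rfl⟩
    have hDb : BddAbove D := by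
      refine ⟨‖φ‖ + ‖S‖, ?_⟩
      rintro _ ⟨y, hy, rfl⟩
      have hy' : ‖y‖ ≤ 1 := by simpa using hy
      exact add_le_add ((le_abs_self _).trans (φ.unit_le_opNorm y hy')) (S.unit_le_opNorm y hy')
    obtain ⟨_, ⟨y₀, hy₀, rfl⟩, hlt⟩ := exists_lt_of_lt_csSup hD (sub_lt_self _ (half_pos hα))
    refine ⟨y₀, by simpa using hy₀, fun y hy => ?_⟩
    have := le_csSup hDb ⟨y, by simpa using hy, rfl⟩
    linarith
  -- Pointing `w` along `S y₀` makes the perturbation add up with `S` at `y₀` without loss, so the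
  -- norm of the sum is at least `φ y₀ + ‖S y₀‖`.
  obtain ⟨w, hw, hSw⟩ : ∃ w : W, ‖w‖ = 1 ∧ S y₀ = (‖S y₀‖ : 𝕜) • w := by
    rcases eq_or_ne (S y₀) 0 with h0 | h0
    · obtain ⟨w, hw⟩ : ∃ w : W, ‖w‖ = 1 := by
        let := NormedSpace.restrictScalars ℝ 𝕜 W
        exact exists_norm_eq W zero_le_one
      exact ⟨w, hw, by simp [h0]⟩
    · have h1 : (‖S y₀‖ : 𝕜) ≠ 0 := by simpa using h0
      refine ⟨(‖S y₀‖ : 𝕜)⁻¹ • S y₀, ?_, by rw [smul_inv_smul₀ h1]⟩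
      rw [norm_smul, norm_inv, RCLike.norm_ofReal, abs_norm, inv_mul_cancel₀ (by simpa using h0)]
  have happ : ∀ y, (S + Φ.smulRight w) y = S y + Φ y • w := fun y => rfl
  have hlow : φ y₀ + ‖S y₀‖ ≤ ‖S + Φ.smulRight w‖ := by
    refine le_trans ?_ ((S + Φ.smulRight w).unit_le_opNorm y₀ hy₀)
    rw [happ]
    nth_rw 2 [hSw]
    rw [← add_smul, norm_smul, hw, mul_one]
    refine le_trans ?_ (RCLike.re_le_norm _)
    rw [map_add, RCLike.ofReal_re, hΦre, add_comm]
  -- One `α / 2` is the defect of `y₀`, the other that of `y`. Rotating `y` so that `Φ y` becomes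
  -- nonnegative turns the triangle inequality bound for the perturbed operator into `φ + ‖S ·‖`.
  refine ⟨Φ, w, hΦ.trans_lt hφ, hw, y₀, α / 2, half_pos hα, fun y hy hy' => ?_⟩
  obtain ⟨θ, hθ, hθy⟩ := RCLike.exists_norm_eq_mul_self (Φ y)
  refine ⟨θ, hθ, hclose' _ _ (by rwa [norm_smul, hθ, one_mul]) hy₀ (fun z hz => ?_)
    fun z hz => by linarith [hy₀max z hz]⟩
  have h1 : φ (θ • y) = ‖Φ y‖ := by
    rw [← hΦre, map_smul, smul_eq_mul, ← hθy, RCLike.ofReal_re]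
  have h2 : ‖S (θ • y)‖ = ‖S y‖ := by rw [map_smul, norm_smul, hθ, one_mul]
  have h3 : ‖(S + Φ.smulRight w) y‖ ≤ ‖S y‖ + ‖Φ y‖ := by
    rw [happ]
    refine (norm_add_le _ _).trans ?_
    rw [norm_smul, hw, mul_one]
  linarith [hy₀max z hz]

end Operators

/-! ### Fréchet differentiability of the norm -/

section Frechet

variable {𝕜 E : Type*} [RCLike 𝕜] [NormedAddCommGroup E] [NormedSpace 𝕜 E]

theorem normFrechetDifferentiableAt_of_subsingleton [Subsingleton E] (x : E) :
    NormFrechetDifferentiableAt 𝕜 x := by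
  let : NormedSpace ℝ E := NormedSpace.restrictScalars ℝ 𝕜 E
  exact (hasFDerivAt_of_subsingleton (𝕜 := ℝ) _ _).differentiableAt

theorem normFrechetDifferentiableAt_of_forall {x : E} (g : StrongDual 𝕜 E)
    (h : ∀ c > 0, ∀ᶠ a in 𝓝 (0 : E), ‖x‖ + RCLike.re (g a) ≤ ‖x + a‖ ∧
      ‖x + a‖ ≤ ‖x‖ + RCLike.re (g a) + c * ‖a‖) : NormFrechetDifferentiableAt 𝕜 x := by
  let : NormedSpace ℝ E := NormedSpace.restrictScalars ℝ 𝕜 E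
  have : IsScalarTower ℝ 𝕜 E := RestrictScalars.isScalarTower ℝ 𝕜 E
  let L : StrongDual ℝ E := RCLike.reCLM.comp (g.restrictScalars ℝ)
  have hL : ∀ a, L a = RCLike.re (g a) := fun a => rfl
  suffices HasFDerivAt (fun z : E => ‖z‖) L x from this.differentiableAt
  rw [hasFDerivAt_iff_isLittleO_nhds_zero, Asymptotics.isLittleO_iff]
  intro c hc
  filter_upwards [h c hc] with a ha
  rw [Real.norm_eq_abs, abs_le, hL]
  constructor <;> linarith [ha.1, ha.2, mul_nonneg hc.le (norm_nonneg a)]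

end Frechet

/-! ### Density and Baire category in closed subspaces -/

section Submodules

variable {𝕜 E F : Type*} [RCLike 𝕜] [NormedAddCommGroup E] [NormedSpace 𝕜 E]
  [NormedAddCommGroup F] [NormedSpace 𝕜 F]

theorem Submodule.dense_setOf_coe_mem (I : Submodule 𝕜 E) {s : Set E}
    (h : ∀ a ∈ I, ∀ r > 0, ∃ b ∈ I, ‖b‖ < r ∧ a + b ∈ s) : Dense {a : I | (a : E) ∈ s} := by
  rw [Metric.dense_iff]
  intro a r hr
  obtain ⟨b, hb, hbr, hs⟩ := h a a.2 r hr
  refine ⟨a + ⟨b, hb⟩, ?_, hs⟩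
  rw [mem_ball, dist_eq_norm, add_sub_cancel_left]
  exact hbr

theorem Submodule.baireSpace_coe [CompleteSpace E] (I : Submodule 𝕜 E)
    (hI : IsClosed (I : Set E)) : BaireSpace I :=
  have : CompleteSpace I := hI.completeSpace_coe
  inferInstance

/-- By the open mapping theorem the restriction of `g` to `I` is open, and preimages of residual
sets under continuous open maps are residual. -/
theorem Submodule.tendsto_residual [CompleteSpace E] [CompleteSpace F] (I : Submodule 𝕜 E)
    (hI : IsClosed (I : Set E)) (g : E →L[𝕜] F) (hg : ∀ b, ∃ a ∈ I, g a = b) :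
    Tendsto (fun a : I => g a) (residual I) (residual F) :=
  have : CompleteSpace I := hI.completeSpace_coe
  tendsto_residual_of_isOpenMap (g.comp I.subtypeL).continuous
    ((g.comp I.subtypeL).isOpenMap fun b => by
      obtain ⟨a, ha, rfl⟩ := hg b
      exact ⟨⟨a, ha⟩, rfl⟩)

end Submodules

/-! ### Operators into a dual space and their flips -/

section Dual

set_option maxSynthPendingDepth 3

variable {𝕜 X Y : Type*} [RCLike 𝕜] [NormedAddCommGroup X] [NormedSpace 𝕜 X]
  [NormedAddCommGroup Y] [NormedSpace 𝕜 Y]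

theorem residual_flip_absStronglyExposesAt [CompleteSpace Y] [Nontrivial X] (hRNP : HasRNP 𝕜 Y)
    (I : Submodule 𝕜 (X →L[𝕜] StrongDual 𝕜 Y))
    (hrank : ∀ (f : StrongDual 𝕜 X) (φ : StrongDual 𝕜 Y), f.smulRight φ ∈ I) :
    ∀ᶠ T : I in residual I, ∃ y₀, AbsStronglyExposesAt (T : X →L[𝕜] StrongDual 𝕜 Y).flip y₀ := by
  have : Nontrivial (StrongDual 𝕜 X) := by
    obtain ⟨g, hg, -⟩ := exists_dual_vector' 𝕜 (0 : X)
    exact ⟨g, 0, fun h => by simp [h] at hg⟩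
  have hU : ∀ n : ℕ, ∀ᶠ T : I in residual I, (T : X →L[𝕜] StrongDual 𝕜 Y).flip ∈
      nearlyStronglyExposing 𝕜 Y (StrongDual 𝕜 X) ((1 / 2) ^ n) := by
    intro n
    refine residual_of_dense_open ?_ ?_
    · exact (isOpen_nearlyStronglyExposing _).preimage
        ((ContinuousLinearMap.flipₗᵢ 𝕜 X Y 𝕜).continuous.comp continuous_subtype_val)
    · refine I.dense_setOf_coe_mem (s := {T | T.flip ∈
        nearlyStronglyExposing 𝕜 Y (StrongDual 𝕜 X) ((1 / 2) ^ n)}) fun T hT r hr => ?_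
      obtain ⟨φ, f, hφ, hf, hmem⟩ := hRNP.exists_add_smulRight_mem T.flip hr
        (by positivity : (0 : ℝ) < (1 / 2) ^ n)
      refine ⟨f.smulRight φ, hrank f φ, ?_, ?_⟩
      · refine lt_of_eq_of_lt (ContinuousLinearMap.norm_smulRight_apply f φ) ?_
        rwa [hf, one_mul]
      · have h1 : (T + f.smulRight φ).flip = T.flip + φ.smulRight f := by
          ext y x
          simp [mul_comm]
        change (T + f.smulRight φ).flip ∈ nearlyStronglyExposing 𝕜 Y (StrongDual 𝕜 X) ((1 / 2) ^ n)
        rwa [h1]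
  filter_upwards [eventually_countable_forall.2 hU] with T hT
  exact exists_absStronglyExposesAt hT

theorem residual_flip_absStronglyExposesAt_mem [CompleteSpace Y] [Nontrivial X] [Nontrivial Y]
    (hRNP : HasRNP 𝕜 Y) (I : Submodule 𝕜 (X →L[𝕜] StrongDual 𝕜 Y))
    (hrank : ∀ (f : StrongDual 𝕜 X) (φ : StrongDual 𝕜 Y), f.smulRight φ ∈ I) {S : Set Y}
    (hS : ∀ a ∈ stronglyExposedPoints 𝕜 (closedBall (0 : Y) 1),
      ∃ s ∈ S, ∃ θ : 𝕜, ‖θ‖ = 1 ∧ a = θ • s) :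
    ∀ᶠ T : I in residual I, ∃ s ∈ S, s ≠ 0 ∧
      AbsStronglyExposesAt (T : X →L[𝕜] StrongDual 𝕜 Y).flip s := by
  filter_upwards [residual_flip_absStronglyExposesAt hRNP I hrank] with T ⟨y₀, hy₀⟩
  obtain ⟨s, hs, θ, hθ, rfl⟩ := hS y₀ (hy₀.mem_stronglyExposedPoints hy₀.ne_zero)
  have hθ0 : θ ≠ 0 := norm_ne_zero_iff.1 (by rw [hθ]; exact one_ne_zero)
  have h1 := hy₀.smul (c := θ⁻¹) (by rw [norm_inv, hθ, inv_one])
  rw [inv_smul_smul₀ hθ0] at h1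
  refine ⟨s, hs, ?_, h1⟩
  rintro rfl
  have h2 := h1.norm_apply
  rw [map_zero, norm_zero] at h2
  exact h1.ne_zero (norm_eq_zero.1 h2.symm)

/-- Evaluation at `s ≠ 0` maps `I` onto `X*`: choose `φ` with `φ s = 1`, and then `f.smulRight φ` is
sent to `f`. -/
theorem residual_flip_apply_mem [CompleteSpace X] (I : Submodule 𝕜 (X →L[𝕜] StrongDual 𝕜 Y))
    (hclosed : IsClosed (I : Set (X →L[𝕜] StrongDual 𝕜 Y)))
    (hrank : ∀ (f : StrongDual 𝕜 X) (φ : StrongDual 𝕜 Y), f.smulRight φ ∈ I)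
    {s : Y} (hs : s ≠ 0) {A : Set (StrongDual 𝕜 X)} (hA : A ∈ residual (StrongDual 𝕜 X)) :
    ∀ᶠ T : I in residual I, (T : X →L[𝕜] StrongDual 𝕜 Y).flip s ∈ A := by
  let ev : (X →L[𝕜] StrongDual 𝕜 Y) →L[𝕜] StrongDual 𝕜 X :=
    (ContinuousLinearMap.apply 𝕜 (StrongDual 𝕜 X) s).comp
      ((ContinuousLinearMap.flipₗᵢ 𝕜 X Y 𝕜).toContinuousLinearEquiv :
        (X →L[𝕜] StrongDual 𝕜 Y) →L[𝕜] (Y →L[𝕜] StrongDual 𝕜 X))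
  refine I.tendsto_residual hclosed ev (fun f => ?_) hA
  obtain ⟨φ, hφ⟩ := SeparatingDual.exists_eq_one (R := 𝕜) hs
  refine ⟨f.smulRight φ, hrank f φ, ?_⟩
  ext x
  change f x * φ s = f x
  rw [hφ, mul_one]

theorem exists_lt_re_apply_apply (A : X →L[𝕜] StrongDual 𝕜 Y) {t : ℝ} (ht : t < ‖A‖) :
    ∃ x y, ‖x‖ ≤ 1 ∧ ‖y‖ ≤ 1 ∧ t < RCLike.re (A x y) := by
  obtain ⟨x, hx, hx'⟩ := A.exists_lt_apply_of_lt_opNorm ht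
  obtain ⟨y, hy, hy'⟩ := (A x).exists_lt_apply_of_lt_opNorm hx'
  obtain ⟨c, hc, hcy⟩ := RCLike.exists_norm_eq_mul_self (A x y)
  refine ⟨x, c • y, hx.le, by rw [norm_smul, hc, one_mul]; exact hy.le, ?_⟩
  rwa [map_smul, smul_eq_mul, ← hcy, RCLike.ofReal_re]

theorem norm_apply_apply_le (A : X →L[𝕜] StrongDual 𝕜 Y) {x : X} {y : Y} (hx : ‖x‖ ≤ 1)
    (hy : ‖y‖ ≤ 1) : ‖A x y‖ ≤ ‖A‖ :=
  ((A x).unit_le_opNorm y hy).trans (A.unit_le_opNorm x hx)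

theorem AbsStronglyExposesAt.norm_flip_apply {T : X →L[𝕜] StrongDual 𝕜 Y} {s : Y}
    (hs : AbsStronglyExposesAt T.flip s) : ‖T.flip s‖ = ‖T‖ := by
  rw [hs.norm_apply, ContinuousLinearMap.opNorm_flip]

theorem AbsStronglyExposesAt.exists_rotations {T : X →L[𝕜] StrongDual 𝕜 Y} {s : Y} {x₀ : X}
    (hs : AbsStronglyExposesAt T.flip s) (hx₀ : AbsStronglyExposesAt (T.flip s) x₀)
    {ι : Type*} {l : Filter ι} {u : ι → X} {v : ι → Y} (hu : ∀ᶠ i in l, ‖u i‖ ≤ 1)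
    (hv : ∀ᶠ i in l, ‖v i‖ ≤ 1) (hT : Tendsto (fun i => ‖T (u i) (v i)‖) l (𝓝 ‖T‖)) :
    ∃ η θ : ι → 𝕜, (∀ i, ‖η i‖ = 1) ∧ (∀ i, ‖θ i‖ = 1) ∧
      Tendsto (fun i => η i • u i) l (𝓝 x₀) ∧ Tendsto (fun i => θ i • v i) l (𝓝 s) := by
  have h1 : Tendsto (fun i => ‖T.flip (v i)‖) l (𝓝 ‖T.flip‖) := by
    rw [ContinuousLinearMap.opNorm_flip]
    refine tendsto_of_tendsto_of_tendsto_of_le_of_le' hT tendsto_const_nhds ?_ ?_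
    · filter_upwards [hu] with i hi
      exact (T.flip (v i)).unit_le_opNorm (u i) hi
    · filter_upwards [hv] with i hi
      rw [← T.opNorm_flip]
      exact T.flip.unit_le_opNorm (v i) hi
  obtain ⟨θ, hθ, hθv⟩ := hs.exists_rotation hv h1
  have h2 : Tendsto (fun i => ‖T.flip s (u i)‖) l (𝓝 ‖T.flip s‖) := by
    rw [hs.norm_flip_apply]
    -- Once the rotated `v i` converge to `s`, replacing them by `s` costs at most `‖T‖ * ‖θ i • v i
    -- - s‖`, so the `u i` are norming for `T.flip s`.
    have h3 : Tendsto (fun i => ‖T (u i) (v i)‖ - ‖T‖ * ‖θ i • v i - s‖) l (𝓝 ‖T‖) := by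
      have := hT.sub ((tendsto_iff_norm_sub_tendsto_zero.1 hθv).const_mul ‖T‖)
      simpa using this
    refine tendsto_of_tendsto_of_tendsto_of_le_of_le' h3 tendsto_const_nhds ?_ ?_
    · filter_upwards [hu] with i hi
      have h4 : ‖T (u i) (θ i • v i)‖ = ‖T (u i) (v i)‖ := by
        rw [map_smul, norm_smul, hθ, one_mul]
      have h5 : ‖T (u i) (θ i • v i) - T (u i) s‖ ≤ ‖T‖ * ‖θ i • v i - s‖ := by
        rw [← map_sub]
        exact (T (u i)).le_of_opNorm_le (T.unit_le_opNorm _ hi) _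
      have h6 := norm_le_norm_add_norm_sub' (T (u i) (θ i • v i)) (T (u i) s)
      rw [ContinuousLinearMap.flip_apply]
      linarith
    · filter_upwards [hu] with i hi
      exact norm_apply_apply_le T hi hs.1
  obtain ⟨η, hη, hηu⟩ := hx₀.exists_rotation hu h2
  exact ⟨η, θ, hη, hθ, hηu, hθv⟩

theorem AbsStronglyExposesAt.absStronglyExposes_of_flip {T : X →L[𝕜] StrongDual 𝕜 Y} {s : Y}
    {x₀ : X} (hs : AbsStronglyExposesAt T.flip s) (hx₀ : AbsStronglyExposesAt (T.flip s) x₀) :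
    AbsStronglyExposes T (closedBall (0 : X) 1) := by
  refine ⟨x₀, by simpa using hx₀.1, fun u hu hlim => ?_⟩
  rw [T.sSup_unitClosedBall_eq_norm] at hlim
  have hu' : ∀ n, ‖u n‖ ≤ 1 := fun n => by simpa using hu n
  choose v hv hv' using fun n : ℕ => (T (u n)).exists_lt_apply_of_lt_opNorm
    (sub_lt_self ‖T (u n)‖ (by positivity : 0 < 1 / ((n : ℝ) + 1)))
  have h1 : Tendsto (fun n => ‖T (u n) (v n)‖) atTop (𝓝 ‖T‖) := by
    have h2 := hlim.sub (tendsto_one_div_add_atTop_nhds_zero_nat (𝕜 := ℝ))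
    rw [sub_zero] at h2
    exact tendsto_of_tendsto_of_tendsto_of_le_of_le h2 tendsto_const_nhds (fun n => (hv' n).le)
      fun n => norm_apply_apply_le T (hu' n) (hv n).le
  obtain ⟨η, -, hη, -, hηu, -⟩ := hs.exists_rotations hx₀ (Eventually.of_forall hu')
    (Eventually.of_forall fun n => (hv n).le) h1
  exact ⟨η, hη, hηu⟩

/-- Pairs at which `T` almost attains its norm define functionals close to the evaluation at
`(x₀, s)`, uniformly on bounded sets of operators. -/
theorem AbsStronglyExposesAt.exists_forall_norm_sub_le {T : X →L[𝕜] StrongDual 𝕜 Y} (hT : T ≠ 0)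
    {s : Y} {x₀ : X} (hs : AbsStronglyExposesAt T.flip s)
    (hx₀ : AbsStronglyExposesAt (T.flip s) x₀) (hval : T x₀ s = (‖T‖ : 𝕜)) {ε : ℝ} (hε : 0 < ε) :
    ∃ δ > 0, ∀ x y, ‖x‖ ≤ 1 → ‖y‖ ≤ 1 → ‖T‖ - δ < RCLike.re (T x y) →
      ∀ A : X →L[𝕜] StrongDual 𝕜 Y, ‖A x y - A x₀ s‖ ≤ ε * ‖A‖ := by
  -- This filter encodes "`re (T x y)` tends to `‖T‖` on the product of the balls"; an eventual
  -- statement along it unfolds into the required `δ`.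
  let l : Filter (X × Y) := comap (fun p => RCLike.re (T p.1 p.2)) (𝓝 ‖T‖) ⊓
    𝓟 {p | ‖p.1‖ ≤ 1 ∧ ‖p.2‖ ≤ 1}
  have hball : ∀ᶠ p in l, ‖p.1‖ ≤ 1 ∧ ‖p.2‖ ≤ 1 := mem_inf_of_right (mem_principal_self _)
  have hre : Tendsto (fun p : X × Y => RCLike.re (T p.1 p.2)) l (𝓝 ‖T‖) :=
    tendsto_comap.mono_left inf_le_left
  have hle : ∀ᶠ p in l, ‖T p.1 p.2‖ ≤ ‖T‖ := by
    filter_upwards [hball] with p hp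
    exact norm_apply_apply_le T hp.1 hp.2
  have hz := tendsto_ofReal_of_tendsto_re hle hre
  have hnorm : Tendsto (fun p : X × Y => ‖T p.1 p.2‖) l (𝓝 ‖T‖) := by
    have h1 := hz.norm
    rwa [RCLike.norm_ofReal, abs_of_nonneg (norm_nonneg T)] at h1
  obtain ⟨η, θ, hη, hθ, hηx, hθy⟩ := hs.exists_rotations hx₀ (hball.mono fun _ h => h.1)
    (hball.mono fun _ h => h.2) hnorm
  have hprod : Tendsto (fun p : X × Y => (η p * θ p) * T p.1 p.2) l (𝓝 (‖T‖ : 𝕜)) := by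
    rw [← hval]
    have hc : Continuous fun p : X × Y => T p.1 p.2 := by fun_prop
    refine ((hc.tendsto (x₀, s)).comp (hηx.prodMk_nhds hθy)).congr fun p => ?_
    simp only [Function.comp_apply, map_smul, _root_.smul_apply, smul_eq_mul]
    ring
  have hT0 : ‖T‖ ≠ 0 := fun h => hT (norm_eq_zero.1 h)
  -- The two rotations need not converge separately, but their product tends to `1`, which is all
  -- that a bilinear form sees.
  have hκ := tendsto_one_of_tendsto_mul (RCLike.ofReal_ne_zero.2 hT0) hz hprod
  have herr : Tendsto (fun p : X × Y => ‖η p * θ p - 1‖ + (‖η p • p.1 - x₀‖ + ‖θ p • p.2 - s‖)) l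
      (𝓝 0) := by
    have := (tendsto_iff_norm_sub_tendsto_zero.1 hκ).add
      ((tendsto_iff_norm_sub_tendsto_zero.1 hηx).add (tendsto_iff_norm_sub_tendsto_zero.1 hθy))
    simpa using this
  have hev : ∀ᶠ p in l, ∀ A : X →L[𝕜] StrongDual 𝕜 Y, ‖A p.1 p.2 - A x₀ s‖ ≤ ε * ‖A‖ := by
    filter_upwards [hball, herr.eventually (gt_mem_nhds hε)] with p hp hpε A
    have h1 : A p.1 p.2 - A x₀ s = -((η p * θ p - 1) * A p.1 p.2) +
        (A (η p • p.1 - x₀) (θ p • p.2) + A x₀ (θ p • p.2 - s)) := by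
      simp only [map_sub, map_smul, _root_.sub_apply, _root_.smul_apply, smul_eq_mul]
      ring
    have h2 : ‖(η p * θ p - 1) * A p.1 p.2‖ ≤ ‖η p * θ p - 1‖ * ‖A‖ := by
      rw [norm_mul]
      exact mul_le_mul_of_nonneg_left (norm_apply_apply_le A hp.1 hp.2) (norm_nonneg _)
    have h3 : ‖A (η p • p.1 - x₀) (θ p • p.2)‖ ≤ ‖η p • p.1 - x₀‖ * ‖A‖ := by
      refine ((A _).unit_le_opNorm _ (by rw [norm_smul, hθ, one_mul]; exact hp.2)).trans ?_
      rw [mul_comm]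
      exact A.le_opNorm _
    have h4 : ‖A x₀ (θ p • p.2 - s)‖ ≤ ‖θ p • p.2 - s‖ * ‖A‖ := by
      rw [mul_comm]
      exact (A x₀).le_of_opNorm_le (A.unit_le_opNorm _ hx₀.1) _
    rw [h1]
    refine (norm_add_le _ _).trans ?_
    rw [norm_neg]
    have h5 := norm_add_le (A (η p • p.1 - x₀) (θ p • p.2)) (A x₀ (θ p • p.2 - s))
    have h6 := mul_le_mul_of_nonneg_right hpε.le (norm_nonneg A)
    linarith
  rw [eventually_inf_principal, eventually_comap, Metric.eventually_nhds_iff] at hev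
  obtain ⟨δ, hδ, h⟩ := hev
  refine ⟨δ, hδ, fun x y hx hy hxy => h (y := RCLike.re (T x y)) ?_ (x, y) rfl ⟨hx, hy⟩⟩
  have h1 : RCLike.re (T x y) ≤ ‖T‖ := (RCLike.re_le_norm _).trans (norm_apply_apply_le T hx hy)
  rw [Real.dist_eq, abs_lt]
  constructor <;> linarith

theorem AbsStronglyExposesAt.normFrechetDifferentiableAt {T : X →L[𝕜] StrongDual 𝕜 Y}
    (hT : T ≠ 0) {s : Y} {x₀ : X} (hs : AbsStronglyExposesAt T.flip s)
    (hx₀ : AbsStronglyExposesAt (T.flip s) x₀) : NormFrechetDifferentiableAt 𝕜 T := by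
  wlog hval : T x₀ s = (‖T‖ : 𝕜) generalizing x₀
  · obtain ⟨c, hc, hcx⟩ := RCLike.exists_norm_eq_mul_self (T x₀ s)
    refine this (hx₀.smul hc) ?_
    rw [map_smul, _root_.smul_apply, smul_eq_mul, ← hcx, ← hs.norm_flip_apply, ← hx₀.norm_apply,
      ContinuousLinearMap.flip_apply]
  let g : (X →L[𝕜] StrongDual 𝕜 Y) →L[𝕜] 𝕜 :=
    (ContinuousLinearMap.apply 𝕜 𝕜 s).comp (ContinuousLinearMap.apply 𝕜 (StrongDual 𝕜 Y) x₀)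
  have hg : ∀ A, g A = A x₀ s := fun A => rfl
  refine normFrechetDifferentiableAt_of_forall g fun c hc => ?_
  obtain ⟨δ, hδ, h⟩ := hs.exists_forall_norm_sub_le hT hx₀ hval (half_pos hc)
  filter_upwards [ball_mem_nhds (0 : X →L[𝕜] StrongDual 𝕜 Y) (by positivity : 0 < δ / 4)] with A hA
  replace hA : ‖A‖ < δ / 4 := mem_ball_zero_iff.1 hA
  rcases eq_or_ne A 0 with rfl | hA0
  · simp
  have hApos : 0 < ‖A‖ := norm_pos_iff.2 hA0
  rw [hg]
  constructor
  · have h1 := (RCLike.re_le_norm _).trans (norm_apply_apply_le (T + A) hx₀.1 hs.1)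
    rw [_root_.add_apply, _root_.add_apply, map_add, hval, RCLike.ofReal_re] at h1
    exact h1
  -- The `δ / 4` and `‖A‖ < δ / 4` make `(x, y)` almost norming for `T` itself, with defect below
  -- `δ`. The error `c * ‖A‖` is half the defect of `(x, y)` for `T + A`, half the cost of replacing
  -- `A x y` by `A x₀ s`.
  · obtain ⟨x, y, hx, hy, hxy⟩ := exists_lt_re_apply_apply (T + A)
      (sub_lt_self ‖T + A‖ (by positivity : 0 < min (δ / 4) (c / 2 * ‖A‖)))
    rw [_root_.add_apply, _root_.add_apply, map_add] at hxy
    have h1 : RCLike.re (A x y) ≤ ‖A‖ :=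
      (RCLike.re_le_norm _).trans (norm_apply_apply_le A hx hy)
    have h2 : RCLike.re (T x y) ≤ ‖T‖ :=
      (RCLike.re_le_norm _).trans (norm_apply_apply_le T hx hy)
    have h3 : ‖T‖ ≤ ‖T + A‖ + ‖A‖ := norm_le_add_norm_add T A
    have h4 := min_le_left (δ / 4) (c / 2 * ‖A‖)
    have h5 := min_le_right (δ / 4) (c / 2 * ‖A‖)
    have h6 := (RCLike.re_le_norm _).trans (h x y hx hy (by linarith) A)
    rw [map_sub] at h6
    linarith

theorem residual_forall_flip_apply_mem [CompleteSpace X] (I : Submodule 𝕜 (X →L[𝕜] StrongDual 𝕜 Y))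
    (hclosed : IsClosed (I : Set (X →L[𝕜] StrongDual 𝕜 Y)))
    (hrank : ∀ (f : StrongDual 𝕜 X) (φ : StrongDual 𝕜 Y), f.smulRight φ ∈ I) {S : Set Y}
    (hS : S.Countable) {A : Set (StrongDual 𝕜 X)} (hA : A ∈ residual (StrongDual 𝕜 X)) :
    ∀ᶠ T : I in residual I, ∀ s ∈ S, s ≠ 0 → (T : X →L[𝕜] StrongDual 𝕜 Y).flip s ∈ A := by
  refine (eventually_countable_ball hS).2 fun s _ => ?_
  by_cases hs : s = 0
  · exact Eventually.of_forall fun T h => (h hs).elim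
  · filter_upwards [residual_flip_apply_mem I hclosed hrank hs hA] with T hT _ using hT

theorem normAttaining_inter_mem_residual [CompleteSpace X] [CompleteSpace Y] (hRNP : HasRNP 𝕜 Y)
    (hcount : CountableUpToRotations 𝕜 (stronglyExposedPoints 𝕜 (closedBall (0 : Y) 1)))
    (I : Submodule 𝕜 (X →L[𝕜] StrongDual 𝕜 Y))
    (hclosed : IsClosed (I : Set (X →L[𝕜] StrongDual 𝕜 Y)))
    (hrank : ∀ (f : StrongDual 𝕜 X) (φ : StrongDual 𝕜 Y), f.smulRight φ ∈ I)
    (hNA : normAttaining 𝕜 X 𝕜 ∈ residual (X →L[𝕜] 𝕜)) :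
    {T : I | (T : X →L[𝕜] StrongDual 𝕜 Y) ∈ normAttaining 𝕜 X (StrongDual 𝕜 Y)}
      ∈ residual I := by
  obtain ⟨S, -, hScount, hS⟩ := hcount
  obtain ⟨f, x₁, hx₁, -⟩ := (dense_of_mem_residual hNA).nonempty
  have : Nontrivial X := ⟨x₁, 0, fun h => by simp [h] at hx₁⟩
  rcases subsingleton_or_nontrivial Y with hY | hY
  · refine Eventually.of_forall fun T => ⟨x₁, hx₁, ?_⟩
    rw [Subsingleton.elim (T : X →L[𝕜] StrongDual 𝕜 Y) 0]
    simp
  · filter_upwards [residual_flip_absStronglyExposesAt_mem hRNP I hrank hS,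
        residual_forall_flip_apply_mem I hclosed hrank hScount hNA]
      with T ⟨s, hsS, hs0, hs⟩ hT
    obtain ⟨x, hx, hTx⟩ := hT s hsS hs0
    refine ⟨x, hx, le_antisymm ((T : X →L[𝕜] StrongDual 𝕜 Y).unit_le_opNorm x hx.le) ?_⟩
    rw [← hs.norm_flip_apply, ← hTx]
    exact ((T : X →L[𝕜] StrongDual 𝕜 Y) x).unit_le_opNorm s hs.1

theorem dense_normFrechetDifferentiableAt_and_dense_absStronglyExposing
    [CompleteSpace X] [CompleteSpace Y] (hRNP : HasRNP 𝕜 Y)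
    (hcount : CountableUpToRotations 𝕜 (stronglyExposedPoints 𝕜 (closedBall (0 : Y) 1)))
    (I : Submodule 𝕜 (X →L[𝕜] StrongDual 𝕜 Y))
    (hclosed : IsClosed (I : Set (X →L[𝕜] StrongDual 𝕜 Y)))
    (hrank : ∀ (f : StrongDual 𝕜 X) (φ : StrongDual 𝕜 Y), f.smulRight φ ∈ I)
    (hSE : Dense (stronglyExposingFunctionals 𝕜 X)) :
    Dense {T : I | NormFrechetDifferentiableAt 𝕜 (T : X →L[𝕜] StrongDual 𝕜 Y)} ∧
      (Nontrivial Y →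
        Dense {T : I | (T : X →L[𝕜] StrongDual 𝕜 Y) ∈
          absStronglyExposingOperators 𝕜 X (StrongDual 𝕜 Y)}) := by
  have : BaireSpace I := I.baireSpace_coe hclosed
  obtain ⟨S, -, hScount, hS⟩ := hcount
  have hdiff0 : Subsingleton (X →L[𝕜] StrongDual 𝕜 Y) →
      Dense {T : I | NormFrechetDifferentiableAt 𝕜 (T : X →L[𝕜] StrongDual 𝕜 Y)} := by
    intro _
    exact dense_univ.mono fun T _ => normFrechetDifferentiableAt_of_subsingleton _
  rcases subsingleton_or_nontrivial X with hX | hX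
  · refine ⟨hdiff0 inferInstance, fun _ => dense_univ.mono fun T _ => ?_⟩
    refine ⟨0, by simp, fun u _ _ => ⟨fun _ => 1, fun _ => norm_one, ?_⟩⟩
    exact tendsto_const_nhds.congr fun n => Subsingleton.elim _ _
  rcases subsingleton_or_nontrivial Y with hY | hY
  · exact ⟨hdiff0 inferInstance, fun h => (not_subsingleton Y hY).elim⟩
  -- Density of the strongly exposing functionals upgrades to residuality of the absolutely strongly
  -- exposing ones, as the latter contain a countable intersection of open sets, each containing the
  -- former.
  have hres : ∀ᶠ f in residual (StrongDual 𝕜 X), ∃ x₀, AbsStronglyExposesAt f x₀ := by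
    have h1 : ∀ n : ℕ, ∀ᶠ f in residual (StrongDual 𝕜 X),
        f ∈ nearlyStronglyExposing 𝕜 X 𝕜 ((1 / 2) ^ n) := fun n =>
      residual_of_dense_open (isOpen_nearlyStronglyExposing _)
        (hSE.mono (stronglyExposingFunctionals_subset (by positivity)))
    filter_upwards [eventually_countable_forall.2 h1] with f hf
    exact exists_absStronglyExposesAt hf
  have hmain : ∀ᶠ T : I in residual I, ∃ s x₀, (T : X →L[𝕜] StrongDual 𝕜 Y) ≠ 0 ∧
      AbsStronglyExposesAt (T : X →L[𝕜] StrongDual 𝕜 Y).flip s ∧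
      AbsStronglyExposesAt ((T : X →L[𝕜] StrongDual 𝕜 Y).flip s) x₀ := by
    filter_upwards [residual_flip_absStronglyExposesAt_mem hRNP I hrank hS,
        residual_forall_flip_apply_mem I hclosed hrank hScount hres]
      with T ⟨s, hsS, hs0, hs⟩ hT
    obtain ⟨x₀, hx₀⟩ := hT s hsS hs0
    exact ⟨s, x₀, fun h => hs.ne_zero (by rw [h]; rfl), hs, hx₀⟩
  have hdense := dense_of_mem_residual hmain
  refine ⟨hdense.mono ?_, fun _ => hdense.mono ?_⟩
  · rintro T ⟨s, x₀, hT, hs, hx₀⟩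
    exact hs.normFrechetDifferentiableAt hT hx₀
  · rintro T ⟨s, x₀, hT, hs, hx₀⟩
    exact hs.absStronglyExposes_of_flip hx₀

end Dual

theorem mainTheorem10 {𝕜 X Y : Type*} [RCLike 𝕜]
    [NormedAddCommGroup X] [NormedSpace 𝕜 X] [CompleteSpace X]
    [NormedAddCommGroup Y] [NormedSpace 𝕜 Y] [CompleteSpace Y]
    (hRNP : HasRNP 𝕜 Y)
    (hcount : CountableUpToRotations 𝕜 (stronglyExposedPoints 𝕜 (closedBall (0 : Y) 1)))
    (I : Submodule 𝕜 (X →L[𝕜] StrongDual 𝕜 Y))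
    (hclosed : IsClosed (I : Set (X →L[𝕜] StrongDual 𝕜 Y)))
    (hrank : ∀ (f : StrongDual 𝕜 X) (φ : StrongDual 𝕜 Y), f.smulRight φ ∈ I) :
    (normAttaining 𝕜 X 𝕜 ∈ residual (X →L[𝕜] 𝕜) →
      {T : I | (T : X →L[𝕜] StrongDual 𝕜 Y) ∈ normAttaining 𝕜 X (StrongDual 𝕜 Y)}
        ∈ residual I) ∧
    (Dense (stronglyExposingFunctionals 𝕜 X) →
      Dense {T : I | NormFrechetDifferentiableAt 𝕜 (T : X →L[𝕜] StrongDual 𝕜 Y)} ∧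
      (Nontrivial Y →
        Dense {T : I | (T : X →L[𝕜] StrongDual 𝕜 Y) ∈
          absStronglyExposingOperators 𝕜 X (StrongDual 𝕜 Y)})) := by
  exact ⟨normAttaining_inter_mem_residual hRNP hcount I hclosed hrank,
    dense_normFrechetDifferentiableAt_and_dense_absStronglyExposing hRNP hcount I hclosed hrank⟩
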